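/- Let $n\ge 0$ be an integer and let $\Sigma\subset\mathbb{R}^{n+1}$ be a closed (that is, compact and without boundary) smooth embedded hypersurface with a smooth unit normal vector field $\mathbf n$. Let $f$ be a smooth real-valued function on $\Sigma$ and let $m\ge 1$ be an integer. For $\varepsilon\in\mathbb{R}$ put $$\Sigma_{\varepsilon f}=\{x+\varepsilon f(x)\,\mathbf n(x) : x\in\Sigma\}.$$ Write $\mathcal H^n$ for the $n$-dimensional Hausdorff measure on $\mathbb R^{n+1}$, normalized to agree with $n$-dimensional Lebesgue measure on $n$-planes; identify a hypersurface $S$ with the measure $\mathcal H^n\lfloor S$, so that $m\Sigma$ denotes $m\,\mathcal H^n\lfloor\Sigma$ and $(m-1)\Sigma+\Sigma_{\varepsilon f}$ denotes $(m-1)\,\mathcal H^n\lfloor\Sigma+\mathcal H^n\lfloor\Sigma_{\varepsilon f}$. For a Borel measure $\mu$ on $\mathbb R^{n+1}$ define its entropy by $$\lambda(\mu)=\sup_{x_0\in\mathbb{R}^{n+1},\ t_0>0}\ \frac{1}{(4\pi t_0)^{n/2}}\int e^{-\frac{|x-x_0|^2}{4t_0}}\,d\mu(x)\in[0,\infty].$$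 Then $\lambda(m\Sigma)<\infty$ and $$\lambda\big((m-1)\Sigma+\Sigma_{\varepsilon f}\big)\to\lambda(m\Sigma)\qquad\text{as }\varepsilon\to 0.$$ -/

import Mathlib

open MeasureTheory Filter Topology
open scoped ENNReal ContDiff InnerProductSpace

noncomputable section

/-- The Euclidean space `ℝⁿ⁺¹`. -/
abbrev AmbientSpace (n : ℕ) : Type := EuclideanSpace ℝ (Fin (n + 1))

/-- `S ⊆ ℝⁿ⁺¹` is a closed (compact, without boundary) smooth embedded hypersurface: it is compact
and near each of its points it is the zero set of a smooth function without critical points. -/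
structure IsClosedHypersurface (n : ℕ) (S : Set (AmbientSpace n)) : Prop where
  isCompact : IsCompact S
  exists_defining_function : ∀ p ∈ S, ∃ (U : Set (AmbientSpace n)) (F : AmbientSpace n → ℝ),
    IsOpen U ∧ p ∈ U ∧ ContDiffOn ℝ ∞ F U ∧ (∀ x ∈ U, fderiv ℝ F x ≠ 0) ∧
      S ∩ U = {x ∈ U | F x = 0}

/-- `g` restricts to a smooth function on the subset `S` of `ℝⁿ⁺¹`: near each point of `S` it
agrees on `S` with a smooth function on an open subset of `ℝⁿ⁺¹`. Only the values of `g` on `S`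
matter. -/
def IsSmoothOnHypersurface {n : ℕ} {V : Type*} [NormedAddCommGroup V] [NormedSpace ℝ V]
    (S : Set (AmbientSpace n)) (g : AmbientSpace n → V) : Prop :=
  ∀ p ∈ S, ∃ (U : Set (AmbientSpace n)) (G : AmbientSpace n → V),
    IsOpen U ∧ p ∈ U ∧ ContDiffOn ℝ ∞ G U ∧ Set.EqOn g G (S ∩ U)

/-- `ν` is a smooth unit normal vector field on the hypersurface `S`; the tangent space of a
hypersurface `S` at `x` is its tangent cone at `x`. -/
structure IsUnitNormalField {n : ℕ} (S : Set (AmbientSpace n))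
    (ν : AmbientSpace n → AmbientSpace n) : Prop where
  smooth : IsSmoothOnHypersurface S ν
  norm_eq_one : ∀ x ∈ S, ‖ν x‖ = 1
  inner_eq_zero : ∀ x ∈ S, ∀ v ∈ tangentConeAt ℝ S x, ⟪v, ν x⟫_ℝ = 0

/-- The normal graph `S_f = {x + f(x) ν(x) : x ∈ S}`. -/
def normalGraph {n : ℕ} (S : Set (AmbientSpace n)) (ν : AmbientSpace n → AmbientSpace n)
    (f : AmbientSpace n → ℝ) : Set (AmbientSpace n) :=
  (fun x => x + f x • ν x) '' S

/-- The measure of a hypersurface with multiplicity one: the `n`-dimensional Hausdorff measure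
(normalized so as to agree with the `n`-dimensional volume) restricted to `S`. -/
def hypersurfaceMeasure (n : ℕ) (S : Set (AmbientSpace n)) : Measure (AmbientSpace n) :=
  (Measure.euclideanHausdorffMeasure n).restrict S

/-- The functional `F_{x₀,t₀}(μ) = (4πt₀)^{-n/2} ∫ exp(-|x-x₀|²/(4t₀)) dμ`. -/
def gaussianF (n : ℕ) (x₀ : AmbientSpace n) (t₀ : ℝ) (μ : Measure (AmbientSpace n)) : ℝ≥0∞ :=
  ENNReal.ofReal (1 / (4 * Real.pi * t₀) ^ ((n : ℝ) / 2)) *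
    ∫⁻ x, ENNReal.ofReal (Real.exp (-‖x - x₀‖ ^ 2 / (4 * t₀))) ∂μ

/-- The entropy `λ(μ)`, the supremum of `F_{x₀,t₀}(μ)` over `x₀ ∈ ℝⁿ⁺¹` and `t₀ > 0`. -/
def entropy (n : ℕ) (μ : Measure (AmbientSpace n)) : ℝ≥0∞ :=
  ⨆ (x₀ : AmbientSpace n) (t₀ : ℝ) (_ : 0 < t₀), gaussianF n x₀ t₀ μ

end

/-! On the compact hypersurface, `f • ν` is Lipschitz and extends to a Lipschitz field `g` of the
ambient space, so the normal graphs are the images of `S` under `x + ε g(x)`. These maps are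
bi-Lipschitz for small `ε`, with constants tending to 1. The behaviour of Hausdorff measure under
Lipschitz maps then replaces the area formula.

Each Gaussian functional is continuous in `ε` (`tendsto_gaussianF_deform`), so the entropy, a
supremum of them, is lower semicontinuous. For the upper bound, subadditivity and `entropy_nsmul`
reduce the claim to multiplicity one. There, scales `t ≥ δ` are controlled uniformly in the centre
by `gaussianF_deform_le`. At scales below `δ` the deformed surfaces are nearly flat, so their
functionals are at most any prescribed `c > 1` (`exists_small_scale_bound`). A nonempty hypersurface
has entropy at least 1 (`one_le_entropy`), so small scales cannot make the entropy jump up. -/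

open scoped NNReal

/-! ### Hausdorff measure and integrals under Lipschitz maps -/

section HausdorffComparison

variable {X Y : Type*} [EMetricSpace X] [MeasurableSpace X] [BorelSpace X]
  [EMetricSpace Y] [MeasurableSpace Y] [BorelSpace Y]

theorem LipschitzOnWith.euclideanHausdorffMeasure_image_le {f : X → Y} {K : ℝ≥0} {s : Set X}
    (hf : LipschitzOnWith K f s) (n : ℕ) : μHE[n] (f '' s) ≤ (K : ℝ≥0∞) ^ n * μHE[n] s := by
  have h := hf.hausdorffMeasure_image_le (Nat.cast_nonneg (α := ℝ) n)
  rw [ENNReal.rpow_natCast] at h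
  simp only [Measure.euclideanHausdorffMeasure_def, Measure.smul_apply, ENNReal.smul_def,
    smul_eq_mul]
  rw [mul_left_comm]
  gcongr

theorem euclideanHausdorffMeasure_le_image {f : X → Y} {K : ℝ≥0} {s : Set X}
    (hf : ∀ x ∈ s, ∀ y ∈ s, edist x y ≤ K * edist (f x) (f y)) (n : ℕ) :
    μHE[n] s ≤ (K : ℝ≥0∞) ^ n * μHE[n] (f '' s) := by
  rcases s.eq_empty_or_nonempty with rfl | ⟨x₀, -⟩
  · simp
  have : Nonempty X := ⟨x₀⟩
  have hinj : Set.InjOn f s := fun x hx y hy h => by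
    simpa [h] using hf x hx y hy
  have hl : LipschitzOnWith K (Function.invFunOn f s) (f '' s) := by
    rintro _ ⟨x, hx, rfl⟩ _ ⟨y, hy, rfl⟩
    rw [hinj.leftInvOn_invFunOn hx, hinj.leftInvOn_invFunOn hy]
    exact hf x hx y hy
  have h := hl.euclideanHausdorffMeasure_image_le n
  rwa [hinj.leftInvOn_invFunOn.image_image] at h

/-- One half of a substitute for the area formula. It follows from an inequality of measures, tested
on Borel sets through `f '' s ∩ B = f '' (s ∩ f ⁻¹' B)`; neither injectivity of `f` nor
measurability of `s` is required. -/
theorem LipschitzWith.setLIntegral_image_le {f : X → Y} {K : ℝ≥0} (hf : LipschitzWith K f)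
    (n : ℕ) (s : Set X) {h : Y → ℝ≥0∞} (hh : Measurable h) :
    ∫⁻ y in f '' s, h y ∂μHE[n] ≤ (K : ℝ≥0∞) ^ n * ∫⁻ x in s, h (f x) ∂μHE[n] := by
  have hm := hf.continuous.measurable
  have hle : (μHE[n]).restrict (f '' s) ≤
      ((K : ℝ≥0∞) ^ n) • ((μHE[n]).restrict s).map f := by
    refine Measure.le_iff.2 fun B hB => ?_
    rw [Measure.restrict_apply hB, Measure.smul_apply, Measure.map_apply hm hB,
      Measure.restrict_apply (hm hB), smul_eq_mul, Set.inter_comm,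
      ← Set.image_inter_preimage, Set.inter_comm]
    exact hf.lipschitzOnWith.euclideanHausdorffMeasure_image_le n
  refine (lintegral_mono' hle le_rfl).trans ?_
  rw [lintegral_smul_measure, lintegral_map hh hm, smul_eq_mul]

theorem setLIntegral_comp_le_image {f : X → Y} {K : ℝ≥0} (hc : Continuous f) {s : Set X}
    (hf : ∀ x ∈ s, ∀ y ∈ s, edist x y ≤ K * edist (f x) (f y)) (n : ℕ)
    {h : Y → ℝ≥0∞} (hh : Measurable h) :
    ∫⁻ x in s, h (f x) ∂μHE[n] ≤ (K : ℝ≥0∞) ^ n * ∫⁻ y in f '' s, h y ∂μHE[n] := by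
  have hm := hc.measurable
  have hle : ((μHE[n]).restrict s).map f ≤
      ((K : ℝ≥0∞) ^ n) • (μHE[n]).restrict (f '' s) := by
    refine Measure.le_iff.2 fun B hB => ?_
    rw [Measure.smul_apply, Measure.restrict_apply hB, Measure.map_apply hm hB,
      Measure.restrict_apply (hm hB), smul_eq_mul, Set.inter_comm, Set.inter_comm B,
      ← Set.image_inter_preimage]
    exact euclideanHausdorffMeasure_le_image (fun x hx y hy => hf x hx.1 y hy.1) n
  rw [← lintegral_map hh hm]
  refine (lintegral_mono' hle le_rfl).trans ?_
  rw [lintegral_smul_measure, smul_eq_mul]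

end HausdorffComparison

/-! ### Estimates for the heat kernel -/

section Gaussian

/-- The unnormalized heat kernel centred at `x₀` at scale `t`. -/
noncomputable def gaussianWeight {V : Type*} [NormedAddCommGroup V] (x₀ : V) (t : ℝ) (x : V) :
    ℝ≥0∞ :=
  ENNReal.ofReal (Real.exp (-‖x - x₀‖ ^ 2 / (4 * t)))

/-- The normalizing constant `(4πt)^{-n/2}`. -/
noncomputable def gaussianConst (n : ℕ) (t : ℝ) : ℝ≥0∞ :=
  ENNReal.ofReal (1 / (4 * Real.pi * t) ^ ((n : ℝ) / 2))

theorem measurable_gaussianWeight {V : Type*} [NormedAddCommGroup V] [MeasurableSpace V]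
    [BorelSpace V] (x₀ : V) (t : ℝ) : Measurable (gaussianWeight x₀ t) := by
  unfold gaussianWeight
  refine (Continuous.measurable ?_).ennreal_ofReal
  fun_prop

theorem gaussianWeight_le_one {V : Type*} [NormedAddCommGroup V] (x₀ : V) {t : ℝ} (ht : 0 < t)
    (x : V) : gaussianWeight x₀ t x ≤ 1 := by
  unfold gaussianWeight
  rw [ENNReal.ofReal_le_one, Real.exp_le_one_iff]
  exact div_nonpos_of_nonpos_of_nonneg (by simp) (by positivity)

theorem lintegral_gaussianWeight (n : ℕ) (z : EuclideanSpace ℝ (Fin n)) {t : ℝ} (ht : 0 < t) :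
    ∫⁻ x, gaussianWeight z t x = ENNReal.ofReal ((4 * Real.pi * t) ^ ((n : ℝ) / 2)) := by
  have hb : (0 : ℝ) < 1 / (4 * t) := by positivity
  have hval := GaussianFourier.integral_rexp_neg_mul_sq_norm (V := EuclideanSpace ℝ (Fin n)) hb
  have hval' : ∫ v : EuclideanSpace ℝ (Fin n), Real.exp (-(1 / (4 * t)) * ‖v‖ ^ 2) =
      (4 * Real.pi * t) ^ ((n : ℝ) / 2) := by
    rw [hval, finrank_euclideanSpace_fin]
    congr 1
    field_simp
  have hpos : (0 : ℝ) < (4 * Real.pi * t) ^ ((n : ℝ) / 2) := by positivity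
  have hint : Integrable fun v : EuclideanSpace ℝ (Fin n) =>
      Real.exp (-(1 / (4 * t)) * ‖v‖ ^ 2) := by
    by_contra h
    rw [integral_undef h] at hval'
    exact hpos.ne hval'
  have h0 : ∫⁻ x : EuclideanSpace ℝ (Fin n), gaussianWeight z t x =
      ∫⁻ x : EuclideanSpace ℝ (Fin n), gaussianWeight 0 t (x - z) := by
    simp [gaussianWeight]
  rw [h0, lintegral_sub_right_eq_self (gaussianWeight (0 : EuclideanSpace ℝ (Fin n)) t) z, ← hval',
    ofReal_integral_eq_lintegral_ofReal hint (ae_of_all _ fun _ => (Real.exp_pos _).le)]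
  refine lintegral_congr fun x => ?_
  simp only [gaussianWeight, sub_zero]
  congr 2
  field_simp

theorem gaussianConst_mul_lintegral_gaussianWeight (n : ℕ) (z : EuclideanSpace ℝ (Fin n)) {t : ℝ}
    (ht : 0 < t) : gaussianConst n t * ∫⁻ x, gaussianWeight z t x ∂μHE[n] = 1 := by
  have hpos : (0 : ℝ) < (4 * Real.pi * t) ^ ((n : ℝ) / 2) := by positivity
  rw [EuclideanSpace.euclideanHausdorffMeasure_eq_volume, lintegral_gaussianWeight n z ht, gaussianConst,
    ← ENNReal.ofReal_mul (by positivity), one_div, inv_mul_cancel₀ hpos.ne', ENNReal.ofReal_one]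

theorem gaussianConst_anti (n : ℕ) {s t : ℝ} (hs : 0 < s) (hst : s ≤ t) :
    gaussianConst n t ≤ gaussianConst n s := by
  unfold gaussianConst
  gcongr

/-- The derivative is bounded by 1 because `2|x| ≤ 1 + x² ≤ exp(x²)`. -/
theorem lipschitz_exp_neg_sq (a b : ℝ) :
    |Real.exp (-a ^ 2) - Real.exp (-b ^ 2)| ≤ |a - b| := by
  have hd : ∀ x : ℝ, HasDerivAt (fun x : ℝ => Real.exp (-x ^ 2))
      (Real.exp (-x ^ 2) * (-(2 * x))) x := fun x => by
    simpa using ((hasDerivAt_pow 2 x).neg).exp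
  have h := Convex.norm_image_sub_le_of_norm_hasDerivWithin_le (s := Set.univ) (C := 1)
    (fun x _ => (hd x).hasDerivWithinAt) (fun x _ => ?_) convex_univ (Set.mem_univ b)
    (Set.mem_univ a)
  · simpa using h
  · rw [norm_mul, Real.norm_eq_abs, Real.norm_eq_abs, abs_neg, abs_mul, Real.abs_exp, abs_two,
      Real.exp_neg, inv_mul_le_one₀ (Real.exp_pos _)]
    have h1 := Real.add_one_le_exp (x ^ 2)
    have h2 : 2 * |x| ≤ x ^ 2 + 1 := by
      nlinarith [sq_nonneg (|x| - 1), sq_abs x]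
    linarith

/-- The weight is `exp(-a²)` with `a = ‖x - x₀‖ / (2√t)`. The error does not depend on `x₀`, which
makes the comparison at scales bounded below uniform in the centre. -/
theorem gaussianWeight_le_add {V : Type*} [NormedAddCommGroup V] (x₀ x y : V) {t : ℝ}
    (ht : 0 < t) : gaussianWeight x₀ t x ≤
      gaussianWeight x₀ t y + ENNReal.ofReal (‖x - y‖ / (2 * √t)) := by
  have key : ∀ z : V, -‖z - x₀‖ ^ 2 / (4 * t) = -(‖z - x₀‖ / (2 * √t)) ^ 2 := fun z => by
    rw [div_pow, mul_pow, Real.sq_sqrt ht.le]; ring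
  unfold gaussianWeight
  rw [← ENNReal.ofReal_add (Real.exp_pos _).le (by positivity)]
  refine ENNReal.ofReal_le_ofReal ?_
  rw [key, key]
  have h := (le_abs_self _).trans (lipschitz_exp_neg_sq (‖x - x₀‖ / (2 * √t)) (‖y - x₀‖ / (2 * √t)))
  have h2 : |‖x - x₀‖ / (2 * √t) - ‖y - x₀‖ / (2 * √t)| ≤ ‖x - y‖ / (2 * √t) := by
    rw [← sub_div, abs_div, abs_of_pos (by positivity : 0 < 2 * √t)]
    gcongr
    simpa using abs_norm_sub_norm_le (x - x₀) (y - x₀)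
  linarith

theorem tendsto_gaussianConst_mul_exp (n : ℕ) {a : ℝ} (ha : 0 < a) :
    Tendsto (fun t => gaussianConst n t * ENNReal.ofReal (Real.exp (-a / t))) (𝓝[>] 0) (𝓝 0) := by
  have h1 := (tendsto_rpow_mul_exp_neg_mul_atTop_nhds_zero ((n : ℝ) / 2) a ha).comp
    tendsto_inv_nhdsGT_zero
  have h2 := h1.const_mul (1 / (4 * Real.pi) ^ ((n : ℝ) / 2))
  rw [mul_zero] at h2
  have h3 := ENNReal.tendsto_ofReal h2
  rw [ENNReal.ofReal_zero] at h3
  refine h3.congr' ?_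
  filter_upwards [self_mem_nhdsWithin] with t ht
  have ht : 0 < t := ht
  unfold gaussianConst
  rw [← ENNReal.ofReal_mul (by positivity)]
  congr 1
  simp only [Function.comp_apply]
  rw [Real.mul_rpow (by positivity) ht.le, Real.inv_rpow ht.le, one_div, one_div, mul_inv,
    mul_assoc, div_eq_mul_inv (-a) t]

end Gaussian

/-! ### Local projections of a hypersurface to hyperplanes -/

section LocalGeometry

/-- The orthogonal projection onto the kernel of a nonzero functional, with the kernel identified
with `ℝⁿ`. -/
theorem exists_projection_along {n : ℕ} (ℓ : AmbientSpace n →L[ℝ] ℝ) (hℓ : ℓ ≠ 0) :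
    ∃ π : AmbientSpace n →L[ℝ] EuclideanSpace ℝ (Fin n),
      ∀ v, ‖v‖ ^ 2 = ‖π v‖ ^ 2 + (ℓ v / ‖ℓ‖) ^ 2 := by
  set N : AmbientSpace n := (InnerProductSpace.toDual ℝ (AmbientSpace n)).symm ℓ with hN
  have hnorm : ‖N‖ = ‖ℓ‖ := by simp [hN]
  have hN0 : N ≠ 0 := by
    rw [← norm_ne_zero_iff, hnorm]
    exact norm_ne_zero_iff.2 hℓ
  have hin : ∀ v, ⟪N, v⟫_ℝ = ℓ v := fun v => InnerProductSpace.toDual_symm_apply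
  have : Fact (Module.finrank ℝ (AmbientSpace n) = n + 1) := ⟨by simp⟩
  let e := (OrthonormalBasis.fromOrthogonalSpanSingleton (𝕜 := ℝ) n hN0).repr
  refine ⟨(e.toContinuousLinearEquiv : _ →L[ℝ] EuclideanSpace ℝ (Fin n)).comp
    ((ℝ ∙ N)ᗮ.orthogonalProjectionOnto), fun v => ?_⟩
  rw [Submodule.norm_sq_eq_add_norm_sq_projection v (ℝ ∙ N), add_comm]
  congr 1
  · simp
  · have h1 : ‖(ℝ ∙ N).orthogonalProjectionOnto v‖ = ‖(ℝ ∙ N).starProjection v‖ := by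
      rw [Submodule.starProjection_apply, Submodule.coe_norm]
    have h0 : ‖N‖ ≠ 0 := norm_ne_zero_iff.2 hN0
    rw [h1, Submodule.starProjection_singleton, hin, norm_smul, ← hnorm]
    simp only [RCLike.ofReal_real_eq_id, id, norm_div, norm_pow, Real.norm_eq_abs, abs_norm]
    rw [mul_pow, div_pow, sq_abs, div_pow]
    field_simp

/-- Near each of its points a closed hypersurface projects almost isometrically onto a
neighbourhood in a hyperplane. -/
theorem IsClosedHypersurface.exists_local_projection {n : ℕ} {S : Set (AmbientSpace n)}
    (hS : IsClosedHypersurface n S) {p : AmbientSpace n} (hp : p ∈ S) {c : ℝ} (hc : 1 < c) :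
    ∃ π : AmbientSpace n →L[ℝ] EuclideanSpace ℝ (Fin n), (∀ v, ‖π v‖ ≤ ‖v‖) ∧
      (∃ r > 0, ∀ x ∈ S ∩ Metric.ball p r, ∀ y ∈ S ∩ Metric.ball p r,
        ‖x - y‖ ≤ c * ‖π x - π y‖) ∧
      ∀ r > 0, π '' (S ∩ Metric.ball p r) ∈ 𝓝 (π p) := by
  obtain ⟨U, F, hU, hpU, hF, hdF, hSU⟩ := hS.exists_defining_function p hp
  have hUp := hU.mem_nhds hpU
  have hstrict : HasStrictFDerivAt F (fderiv ℝ F p) p :=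
    (hF.contDiffAt hUp).hasStrictFDerivAt (by simp)
  set ℓ := fderiv ℝ F p with hℓdef
  have hℓ : ℓ ≠ 0 := hdF p hpU
  have hℓn : 0 < ‖ℓ‖ := norm_pos_iff.2 hℓ
  have hzero : ∀ x ∈ S, x ∈ U → F x = 0 := fun x hx hxU =>
    ((Set.ext_iff.1 hSU x).1 ⟨hx, hxU⟩).2
  obtain ⟨π, hπ⟩ := exists_projection_along ℓ hℓ
  refine ⟨π, fun v => ?_, ?_, fun r hr => ?_⟩
  · exact le_of_sq_le_sq (by nlinarith [hπ v, sq_nonneg (ℓ v / ‖ℓ‖)]) (norm_nonneg v)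
  -- `κ` bounds the normal share of a chord: since `1 - κ² = c⁻²`, the tangential part keeps at
  -- least `c⁻¹` of its length. Strict differentiability supplies the bound, as `F` vanishes at both
  -- endpoints.
  · set κ := √(1 - (c ^ 2)⁻¹) with hκ
    have hc2 : 1 < c ^ 2 := by nlinarith
    have hk : 0 < 1 - (c ^ 2)⁻¹ := sub_pos.2 (inv_lt_one_of_one_lt₀ hc2)
    have hκpos : 0 < κ := Real.sqrt_pos.2 hk
    have hκsq : κ ^ 2 = 1 - (c ^ 2)⁻¹ := Real.sq_sqrt hk.le
    have hev := (hasStrictFDerivAt_iff_isLittleO.1 hstrict).def (mul_pos hκpos hℓn)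
    have hev' := hev.and (prod_mem_nhds hUp hUp)
    rw [Metric.eventually_nhds_iff_ball] at hev'
    obtain ⟨r, hr, hball⟩ := hev'
    refine ⟨r, hr, fun x hx y hy => ?_⟩
    obtain ⟨h1, h2, h3⟩ := hball (x, y) (by
      rw [← ball_prod_same]; exact ⟨hx.2, hy.2⟩)
    simp only [hzero x hx.1 h2, hzero y hy.1 h3, sub_self, zero_sub, norm_neg,
      Real.norm_eq_abs] at h1
    have h4 : |ℓ (x - y) / ‖ℓ‖| ≤ κ * ‖x - y‖ := by
      rw [abs_div, abs_norm, div_le_iff₀ hℓn]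
      linarith
    have h5 : (ℓ (x - y) / ‖ℓ‖) ^ 2 ≤ κ ^ 2 * ‖x - y‖ ^ 2 := by
      rw [← mul_pow, ← sq_abs]
      gcongr
    have h6 := hπ (x - y)
    rw [hκsq] at h5
    have h7 : (c ^ 2)⁻¹ * ‖x - y‖ ^ 2 ≤ ‖π (x - y)‖ ^ 2 := by linarith
    rw [inv_mul_le_iff₀ (by positivity), ← mul_pow] at h7
    rw [← map_sub]
    exact le_of_sq_le_sq h7 (by positivity)
  -- The map `(π, F)` has invertible derivative at `p`, so it is open there; the slice `F = 0` of an
  -- image neighbourhood comes from `S`.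
  · have hinj : Function.Injective (π.prod ℓ) := by
      rw [injective_iff_map_eq_zero]
      intro v hv
      have h1 : π v = 0 := congrArg Prod.fst hv
      have h2 : ℓ v = 0 := congrArg Prod.snd hv
      have h3 := hπ v
      simpa [h1, h2] using h3
    have hsurj : Function.Surjective (π.prod ℓ) :=
      (LinearMap.injective_iff_surjective_of_finrank_eq_finrank
        (f := (π.prod ℓ : AmbientSpace n →ₗ[ℝ] EuclideanSpace ℝ (Fin n) × ℝ)) (by simp)).1 hinj
    have hG : HasStrictFDerivAt (fun x => (π x, F x)) (π.prod ℓ) p :=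
      π.hasStrictFDerivAt.prodMk hstrict
    have hmap := hG.map_nhds_eq_of_surj (LinearMap.range_eq_top.2 hsurj)
    have hmem : (fun x => (π x, F x)) '' (U ∩ Metric.ball p r) ∈ 𝓝 (π p, F p) := by
      rw [← hmap]
      exact image_mem_map (inter_mem hUp (Metric.ball_mem_nhds p hr))
    rw [hzero p hp hpU] at hmem
    have hcont : ContinuousAt (fun z : EuclideanSpace ℝ (Fin n) => (z, (0 : ℝ))) (π p) := by
      fun_prop
    filter_upwards [hcont hmem] with z hz
    obtain ⟨x, hx, hxz⟩ := hz
    simp only [Prod.mk.injEq] at hxz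
    exact ⟨x, ⟨((Set.ext_iff.1 hSU x).2 ⟨hx.1, hxz.2⟩).1, hx.2⟩, hxz.1⟩

/-- A Lebesgue number of the cover by the local balls serves as a radius independent of the point.
-/
theorem IsClosedHypersurface.exists_uniform_projection {n : ℕ} {S : Set (AmbientSpace n)}
    (hS : IsClosedHypersurface n S) {c : ℝ} (hc : 1 < c) :
    ∃ r > 0, ∀ p ∈ S, ∃ π : AmbientSpace n →L[ℝ] EuclideanSpace ℝ (Fin n),
      (∀ v, ‖π v‖ ≤ ‖v‖) ∧ ∀ x ∈ S ∩ Metric.ball p r, ∀ y ∈ S ∩ Metric.ball p r,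
        ‖x - y‖ ≤ c * ‖π x - π y‖ := by
  choose! π hπ hr _ using fun p (hp : p ∈ S) => hS.exists_local_projection hp hc
  choose! r hr0 hr using hr
  obtain ⟨δ, hδ, h⟩ := lebesgue_number_lemma_of_metric
    (c := fun p : S => Metric.ball (p : AmbientSpace n) (r p)) hS.isCompact (fun _ => Metric.isOpen_ball)
    (fun p hp => Set.mem_iUnion.2 ⟨⟨p, hp⟩, Metric.mem_ball_self (hr0 p hp)⟩)
  refine ⟨δ, hδ, fun p hp => ?_⟩
  obtain ⟨q, hq⟩ := h p hp
  exact ⟨π q, hπ q q.2, fun x hx y hy => hr q q.2 x ⟨hx.1, hq hx.2⟩ y ⟨hy.1, hq hy.2⟩⟩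

theorem IsSmoothOnHypersurface.locallyLipschitzOn {n : ℕ} {V : Type*} [NormedAddCommGroup V]
    [NormedSpace ℝ V] {S : Set (AmbientSpace n)} {g : AmbientSpace n → V}
    (hg : IsSmoothOnHypersurface S g) : LocallyLipschitzOn S g := by
  intro p hp
  obtain ⟨U, G, hU, hpU, hG, hgG⟩ := hg p hp
  obtain ⟨K, t, ht, hK⟩ := ((hG.contDiffAt (hU.mem_nhds hpU)).of_le
    (by simp : (1 : ℕ∞ω) ≤ ((⊤ : ℕ∞) : ℕ∞ω))).exists_lipschitzOnWith
  refine ⟨K, S ∩ (U ∩ t), inter_mem_nhdsWithin S (inter_mem (hU.mem_nhds hpU) ht), ?_⟩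
  intro x hx y hy
  rw [hgG ⟨hx.1, hx.2.1⟩, hgG ⟨hy.1, hy.2.1⟩]
  exact hK hx.2.2 hy.2.2

theorem IsSmoothOnHypersurface.smul {n : ℕ} {V : Type*} [NormedAddCommGroup V]
    [NormedSpace ℝ V] {S : Set (AmbientSpace n)} {f : AmbientSpace n → ℝ} {g : AmbientSpace n → V}
    (hf : IsSmoothOnHypersurface S f) (hg : IsSmoothOnHypersurface S g) :
    IsSmoothOnHypersurface S (fun x => f x • g x) := by
  intro p hp
  obtain ⟨U, F, hU, hpU, hF, hfF⟩ := hf p hp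
  obtain ⟨W, G, hW, hpW, hG, hgG⟩ := hg p hp
  refine ⟨U ∩ W, fun x => F x • G x, hU.inter hW, ⟨hpU, hpW⟩,
    (hF.mono Set.inter_subset_left).smul (hG.mono Set.inter_subset_right), fun x hx => ?_⟩
  simp only [hfF ⟨hx.1, hx.2.1⟩, hgG ⟨hx.1, hx.2.2⟩]

end LocalGeometry

/-! ### Perturbations of the identity by a Lipschitz field -/

section Deformation

theorem edist_le_mul_edist_of_norm {V W : Type*} [SeminormedAddCommGroup V]
    [SeminormedAddCommGroup W] {K : ℝ≥0} {x y : V} {u v : W} (h : ‖x - y‖ ≤ K * ‖u - v‖) :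
    edist x y ≤ K * edist u v := by
  rw [edist_dist, edist_dist, dist_eq_norm, dist_eq_norm, ← ENNReal.ofReal_coe_nnreal,
    ← ENNReal.ofReal_mul K.coe_nonneg]
  exact ENNReal.ofReal_le_ofReal h

/-- The deformation `x ↦ x + ε g(x)`. -/
def deform {V : Type*} [NormedAddCommGroup V] [NormedSpace ℝ V] (g : V → V) (ε : ℝ) (x : V) : V :=
  x + ε • g x

variable {V : Type*} [NormedAddCommGroup V] [NormedSpace ℝ V] {g : V → V} {L : ℝ≥0}

theorem norm_deform_sub_deform_sub_le (hg : LipschitzWith L g) (ε : ℝ) (x y : V) :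
    ‖(deform g ε x - deform g ε y) - (x - y)‖ ≤ ‖ε‖ * L * ‖x - y‖ := by
  have h : (deform g ε x - deform g ε y) - (x - y) = ε • (g x - g y) := by
    simp only [deform, smul_sub]; abel
  rw [h, norm_smul, mul_assoc]
  gcongr
  exact hg.norm_sub_le x y

theorem norm_deform_sub_deform_le (hg : LipschitzWith L g) (ε : ℝ) (x y : V) :
    ‖deform g ε x - deform g ε y‖ ≤ (1 + ‖ε‖ * L) * ‖x - y‖ := by
  have h1 := norm_deform_sub_deform_sub_le hg ε x y
  have h2 := norm_le_norm_add_norm_sub' (deform g ε x - deform g ε y) (x - y)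
  linarith

theorem lipschitzWith_deform (hg : LipschitzWith L g) (ε : ℝ) :
    LipschitzWith (1 + ‖ε‖₊ * L) (deform g ε) := fun x y =>
  edist_le_mul_edist_of_norm (by simpa using norm_deform_sub_deform_le hg ε x y)

theorem edist_le_mul_edist_deform (hg : LipschitzWith L g) {ε : ℝ} (hε : ‖ε‖₊ * L < 1) (x y : V) :
    edist x y ≤ ((1 - ‖ε‖₊ * L)⁻¹ : ℝ≥0) * edist (deform g ε x) (deform g ε y) := by
  have hε' : ‖ε‖ * L < 1 := by exact_mod_cast hε
  refine edist_le_mul_edist_of_norm ?_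
  rw [NNReal.coe_inv, NNReal.coe_sub hε.le, le_inv_mul_iff₀ (by push_cast; simpa using hε')]
  push_cast
  have h1 := norm_deform_sub_deform_sub_le hg ε x y
  have h2 := norm_le_norm_add_norm_sub (deform g ε x - deform g ε y) (x - y)
  linarith

end Deformation

/-! ### Comparison of Gaussian functionals -/

section Estimates

theorem gaussianF_hypersurfaceMeasure (n : ℕ) (x₀ : AmbientSpace n) (t : ℝ)
    (S : Set (AmbientSpace n)) : gaussianF n x₀ t (hypersurfaceMeasure n S) =
      gaussianConst n t * ∫⁻ x in S, gaussianWeight x₀ t x ∂μHE[n] := rfl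

/-- Projecting brings points closer to the centre, so it increases the weight; the `K`-Lipschitz
inverse costs `K ^ n`, and the full Gaussian integral on `ℝⁿ` is 1. -/
theorem gaussianF_le_pow_of_projection {n : ℕ} {A : Set (AmbientSpace n)}
    (π : AmbientSpace n →L[ℝ] EuclideanSpace ℝ (Fin n)) (hπ : ∀ v, ‖π v‖ ≤ ‖v‖) {K : ℝ≥0}
    (hA : ∀ x ∈ A, ∀ y ∈ A, ‖x - y‖ ≤ K * ‖π x - π y‖) (x₀ : AmbientSpace n) {t : ℝ}
    (ht : 0 < t) :
    gaussianF n x₀ t (hypersurfaceMeasure n A) ≤ (K : ℝ≥0∞) ^ n := by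
  rw [gaussianF_hypersurfaceMeasure]
  have h1 : ∫⁻ x in A, gaussianWeight x₀ t x ∂μHE[n] ≤
      (K : ℝ≥0∞) ^ n * ∫⁻ z, gaussianWeight (π x₀) t z ∂μHE[n] := by
    calc ∫⁻ x in A, gaussianWeight x₀ t x ∂μHE[n]
        ≤ ∫⁻ x in A, gaussianWeight (π x₀) t (π x) ∂μHE[n] := by
          refine lintegral_mono fun x => ?_
          unfold gaussianWeight
          rw [← map_sub]
          gcongr
          exact hπ _
      _ ≤ (K : ℝ≥0∞) ^ n * ∫⁻ z in π '' A, gaussianWeight (π x₀) t z ∂μHE[n] :=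
          setLIntegral_comp_le_image π.continuous
            (fun x hx y hy => edist_le_mul_edist_of_norm (hA x hx y hy)) n
            (measurable_gaussianWeight _ _)
      _ ≤ _ := mul_le_mul_right (setLIntegral_le_lintegral _ _) _
  calc _ ≤ gaussianConst n t *
        ((K : ℝ≥0∞) ^ n * ∫⁻ z, gaussianWeight (π x₀) t z ∂μHE[n]) := by gcongr
    _ = _ := by
      rw [mul_left_comm, gaussianConst_mul_lintegral_gaussianWeight n (π x₀) ht, mul_one]

theorem IsClosedHypersurface.measure_lt_top {n : ℕ} {S : Set (AmbientSpace n)}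
    (hS : IsClosedHypersurface n S) : μHE[n] S < ⊤ := by
  obtain ⟨r, hr, h⟩ := hS.exists_uniform_projection one_lt_two
  refine hS.isCompact.measure_lt_top_of_nhdsWithin fun p hp => ?_
  refine ⟨S ∩ Metric.ball p r, inter_mem_nhdsWithin S (Metric.ball_mem_nhds p hr), ?_⟩
  obtain ⟨π, -, hπ⟩ := h p hp
  have hle : μHE[n] (S ∩ Metric.ball p r) ≤
      ((2 : ℝ≥0) : ℝ≥0∞) ^ n * μHE[n] (π '' (S ∩ Metric.ball p r)) :=
    euclideanHausdorffMeasure_le_image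
      (fun x hx y hy => edist_le_mul_edist_of_norm (by simpa using hπ x hx y hy)) n
  refine hle.trans_lt (ENNReal.mul_lt_top (by simp) ?_)
  rw [EuclideanSpace.euclideanHausdorffMeasure_eq_volume]
  exact (π.lipschitz.isBounded_image
    (Metric.isBounded_ball.subset Set.inter_subset_right)).measure_lt_top

theorem IsClosedHypersurface.measurableSet {n : ℕ} {S : Set (AmbientSpace n)}
    (hS : IsClosedHypersurface n S) : MeasurableSet S := hS.isCompact.measurableSet

theorem gaussianConst_ne_top (n : ℕ) (t : ℝ) : gaussianConst n t ≠ ⊤ := ENNReal.ofReal_ne_top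

theorem lintegral_gaussianWeight_le_add {n : ℕ} {S : Set (AmbientSpace n)} (hS : MeasurableSet S)
    (φ ψ : AmbientSpace n → AmbientSpace n) {d : ℝ}
    (hd : ∀ x ∈ S, ‖φ x - ψ x‖ ≤ d) (hψ : Measurable ψ) (x₀ : AmbientSpace n) {t : ℝ}
    (ht : 0 < t) :
    ∫⁻ x in S, gaussianWeight x₀ t (φ x) ∂μHE[n] ≤
      ∫⁻ x in S, gaussianWeight x₀ t (ψ x) ∂μHE[n] + ENNReal.ofReal (d / (2 * √t)) * μHE[n] S := by
  have hm : Measurable fun x => gaussianWeight x₀ t (ψ x) :=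
    (measurable_gaussianWeight x₀ t).comp hψ
  rw [← setLIntegral_const, ← lintegral_add_left hm]
  refine setLIntegral_mono' hS fun x hx => ?_
  refine (gaussianWeight_le_add x₀ (φ x) (ψ x) ht).trans ?_
  gcongr
  exact hd x hx

variable {n : ℕ} {S : Set (AmbientSpace n)} {g : AmbientSpace n → AmbientSpace n} {L : ℝ≥0} {M : ℝ}

theorem norm_deform_sub_le (hM : ∀ x ∈ S, ‖g x‖ ≤ M) (ε : ℝ) :
    ∀ x ∈ S, ‖deform g ε x - x‖ ≤ ‖ε‖ * M := fun x hx => by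
  simp only [deform, add_sub_cancel_left, norm_smul]
  gcongr
  exact hM x hx

/-- Upper bound for the Gaussian functional of the deformed set at scales bounded below. -/
theorem gaussianF_deform_le (hS : MeasurableSet S) (hg : LipschitzWith L g)
    (hM : ∀ x ∈ S, ‖g x‖ ≤ M) (ε : ℝ) (x₀ : AmbientSpace n) {δ t : ℝ} (hδ : 0 < δ) (ht : δ ≤ t) :
    gaussianF n x₀ t (hypersurfaceMeasure n (deform g ε '' S)) ≤
      ((1 + ‖ε‖₊ * L : ℝ≥0) : ℝ≥0∞) ^ n * (gaussianF n x₀ t (hypersurfaceMeasure n S) +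
        gaussianConst n δ * (ENNReal.ofReal (‖ε‖ * M / (2 * √δ)) * μHE[n] S)) := by
  have ht0 := hδ.trans_le ht
  rcases S.eq_empty_or_nonempty with rfl | ⟨z, hz⟩
  · simp [gaussianF_hypersurfaceMeasure]
  -- This sign lets the error at scale `t` be bounded by the one at scale `δ`; for empty `S` it
  -- could fail.
  have hM0 : 0 ≤ M := (norm_nonneg _).trans (hM z hz)
  simp only [gaussianF_hypersurfaceMeasure]
  calc _ ≤ gaussianConst n t * (((1 + ‖ε‖₊ * L : ℝ≥0) : ℝ≥0∞) ^ n *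
        ∫⁻ x in S, gaussianWeight x₀ t (deform g ε x) ∂μHE[n]) := by
        gcongr
        exact (lipschitzWith_deform hg ε).setLIntegral_image_le n S (measurable_gaussianWeight _ _)
    _ ≤ gaussianConst n t * (((1 + ‖ε‖₊ * L : ℝ≥0) : ℝ≥0∞) ^ n *
        (∫⁻ x in S, gaussianWeight x₀ t x ∂μHE[n] +
          ENNReal.ofReal (‖ε‖ * M / (2 * √t)) * μHE[n] S)) := by
        gcongr
        exact lintegral_gaussianWeight_le_add hS (deform g ε) id (norm_deform_sub_le hM ε)
          measurable_id x₀ ht0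
    _ = ((1 + ‖ε‖₊ * L : ℝ≥0) : ℝ≥0∞) ^ n * (gaussianConst n t *
        ∫⁻ x in S, gaussianWeight x₀ t x ∂μHE[n] +
          gaussianConst n t * (ENNReal.ofReal (‖ε‖ * M / (2 * √t)) * μHE[n] S)) := by ring
    _ ≤ _ := by
        gcongr
        exact gaussianConst_anti n hδ ht

/-- Lower bound for the Gaussian functional of the deformed set. -/
theorem gaussianF_le_deform (hS : MeasurableSet S) (hg : LipschitzWith L g)
    (hM : ∀ x ∈ S, ‖g x‖ ≤ M) {ε : ℝ} (hε : ‖ε‖₊ * L < 1) (x₀ : AmbientSpace n) {t : ℝ}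
    (ht : 0 < t) :
    gaussianF n x₀ t (hypersurfaceMeasure n S) ≤
      (((1 - ‖ε‖₊ * L)⁻¹ : ℝ≥0) : ℝ≥0∞) ^ n *
        gaussianF n x₀ t (hypersurfaceMeasure n (deform g ε '' S)) +
        gaussianConst n t * (ENNReal.ofReal (‖ε‖ * M / (2 * √t)) * μHE[n] S) := by
  have hcont := (lipschitzWith_deform hg ε).continuous
  simp only [gaussianF_hypersurfaceMeasure]
  rw [mul_left_comm, ← mul_add]
  gcongr
  refine (lintegral_gaussianWeight_le_add hS id (deform g ε) (d := ‖ε‖ * M) (fun x hx => ?_)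
    hcont.measurable x₀ ht).trans ?_
  · rw [id, norm_sub_rev]
    exact norm_deform_sub_le hM ε x hx
  · gcongr
    exact setLIntegral_comp_le_image hcont (fun x _ y _ => edist_le_mul_edist_deform hg hε x y) n
      (measurable_gaussianWeight _ _)

theorem gaussianF_le_of_far {A : Set (AmbientSpace n)} (hA : MeasurableSet A)
    {x₀ : AmbientSpace n} {ρ : ℝ} (hρ : 0 ≤ ρ) (hfar : ∀ x ∈ A, ρ ≤ ‖x - x₀‖) {t : ℝ} (ht : 0 < t) :
    gaussianF n x₀ t (hypersurfaceMeasure n A) ≤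
      gaussianConst n t * ENNReal.ofReal (Real.exp (-(ρ ^ 2 / 4) / t)) * μHE[n] A := by
  rw [gaussianF_hypersurfaceMeasure, mul_assoc, ← setLIntegral_const]
  refine mul_le_mul_right ?_ _
  refine setLIntegral_mono' hA fun x hx => ?_
  unfold gaussianWeight
  refine ENNReal.ofReal_le_ofReal (Real.exp_le_exp.2 ?_)
  rw [neg_div, neg_div, neg_le_neg_iff, div_div]
  gcongr
  exact hfar x hx

theorem gaussianF_union_le (x₀ : AmbientSpace n) (t : ℝ) (A B : Set (AmbientSpace n)) :
    gaussianF n x₀ t (hypersurfaceMeasure n (A ∪ B)) ≤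
      gaussianF n x₀ t (hypersurfaceMeasure n A) + gaussianF n x₀ t (hypersurfaceMeasure n B) := by
  simp only [gaussianF_hypersurfaceMeasure, ← mul_add]
  gcongr
  exact lintegral_union_le _ _ _

theorem gaussianF_mono {A B : Set (AmbientSpace n)} (h : A ⊆ B) (x₀ : AmbientSpace n) (t : ℝ) :
    gaussianF n x₀ t (hypersurfaceMeasure n A) ≤ gaussianF n x₀ t (hypersurfaceMeasure n B) := by
  simp only [gaussianF_hypersurfaceMeasure]
  gcongr

end Estimates

/-! ### Small scales and the lower bound 1 for the entropy -/

section SmallScales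

variable {n : ℕ} {S : Set (AmbientSpace n)} {g : AmbientSpace n → AmbientSpace n} {L : ℝ≥0}

/-- The deformation stretches a chord by at most `1 + ‖ε‖ L`, while the projected chord, at least
`c⁻¹‖x - y‖` before, loses at most `‖ε‖ L ‖x - y‖`. -/
theorem norm_deform_le_of_projection {W : Type*} [NormedAddCommGroup W] [NormedSpace ℝ W]
    (hg : LipschitzWith L g) (π : AmbientSpace n →L[ℝ] W) (hπ : ∀ v, ‖π v‖ ≤ ‖v‖) {c K ε : ℝ}
    (hc : 0 < c) (hK : 0 ≤ K) (hε : 1 + ‖ε‖ * L ≤ K * (c⁻¹ - ‖ε‖ * L)) {x y : AmbientSpace n}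
    (hxy : ‖x - y‖ ≤ c * ‖π x - π y‖) :
    ‖deform g ε x - deform g ε y‖ ≤ K * ‖π (deform g ε x) - π (deform g ε y)‖ := by
  have h1 := norm_deform_sub_deform_le hg ε x y
  have h2 : ‖π (deform g ε x - deform g ε y) - π (x - y)‖ ≤ ‖ε‖ * L * ‖x - y‖ := by
    rw [← map_sub]
    exact (hπ _).trans (norm_deform_sub_deform_sub_le hg ε x y)
  have h3 := norm_le_norm_add_norm_sub (π (deform g ε x - deform g ε y)) (π (x - y))
  rw [← map_sub] at hxy ⊢
  have h4 : c⁻¹ * ‖x - y‖ ≤ ‖π (x - y)‖ := (inv_mul_le_iff₀ hc).2 hxy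
  have h5 : (c⁻¹ - ‖ε‖ * L) * ‖x - y‖ ≤ ‖π (deform g ε x - deform g ε y)‖ := by linarith
  calc _ ≤ (1 + ‖ε‖ * L) * ‖x - y‖ := h1
    _ ≤ K * (c⁻¹ - ‖ε‖ * L) * ‖x - y‖ := by gcongr
    _ = K * ((c⁻¹ - ‖ε‖ * L) * ‖x - y‖) := by ring
    _ ≤ _ := by gcongr

/-- At small scales the Gaussian functionals of all small deformations of a closed hypersurface are
uniformly almost bounded by `1`. -/
theorem IsClosedHypersurface.exists_small_scale_bound (hS : IsClosedHypersurface n S)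
    (hg : LipschitzWith L g) {c : ℝ≥0∞} (hc : 1 < c) :
    ∃ δ > 0, ∀ᶠ ε in 𝓝 (0 : ℝ), ∀ (x₀ : AmbientSpace n) (t : ℝ), 0 < t → t < δ →
      gaussianF n x₀ t (hypersurfaceMeasure n (deform g ε '' S)) ≤ c := by
  obtain ⟨K, hKc, hK⟩ : ∃ K : ℝ≥0, (K : ℝ≥0∞) ^ n < c ∧ 1 < K := by
    have hcont : Continuous fun K : ℝ≥0 => (K : ℝ≥0∞) ^ n := by fun_prop
    have h : Tendsto (fun K : ℝ≥0 => (K : ℝ≥0∞) ^ n) (𝓝[>] 1) (𝓝 1) :=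
      (hcont.tendsto' 1 1 (by simp)).mono_left nhdsWithin_le_nhds
    exact ((h.eventually_lt_const hc).and self_mem_nhdsWithin).exists
  have hK1 : (1 : ℝ) < K := by exact_mod_cast hK
  -- The gap between `c₁` and `K` absorbs the distortion caused by the deformation.
  obtain ⟨c₁, hc₁, hc₁K⟩ := exists_between hK1
  obtain ⟨r, hr, hproj⟩ := hS.exists_uniform_projection hc₁
  obtain ⟨M, hM⟩ := hS.isCompact.exists_bound_of_continuousOn hg.continuous.continuousOn
  have htail : Tendsto (fun t => (K : ℝ≥0∞) ^ n + gaussianConst n t *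
      ENNReal.ofReal (Real.exp (-((r / 8) ^ 2 / 4) / t)) * (2 ^ n * μHE[n] S)) (𝓝[>] 0)
      (𝓝 ((K : ℝ≥0∞) ^ n)) := by
    have h := ENNReal.Tendsto.mul_const (b := 2 ^ n * μHE[n] S)
      (tendsto_gaussianConst_mul_exp n (a := (r / 8) ^ 2 / 4) (by positivity))
      (Or.inr (ENNReal.mul_ne_top (by simp) hS.measure_lt_top.ne))
    simpa using h.const_add ((K : ℝ≥0∞) ^ n)
  obtain ⟨δ, hδ, hδt⟩ := mem_nhdsGT_iff_exists_Ioo_subset.1 (htail.eventually_lt_const hKc)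
  refine ⟨δ, hδ, ?_⟩
  have h1 : ∀ᶠ ε in 𝓝 (0 : ℝ), ‖ε‖ * L < 1 :=
    (Continuous.tendsto' (by fun_prop) 0 0 (by simp)).eventually_lt_const one_pos
  have h2 : ∀ᶠ ε in 𝓝 (0 : ℝ), ‖ε‖ * M < r / 8 :=
    (Continuous.tendsto' (by fun_prop) 0 0 (by simp)).eventually_lt_const (by positivity)
  have h3 : ∀ᶠ ε in 𝓝 (0 : ℝ), 0 < K * (c₁⁻¹ - ‖ε‖ * L) - (1 + ‖ε‖ * L) := by
    have hcont : Continuous fun ε : ℝ => K * (c₁⁻¹ - ‖ε‖ * L) - (1 + ‖ε‖ * L) := by fun_prop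
    refine (hcont.tendsto' 0 (K * c₁⁻¹ - 1) (by simp)).eventually_const_lt ?_
    rw [sub_pos, ← div_eq_mul_inv, one_lt_div (by linarith)]
    exact hc₁K
  filter_upwards [h1, h2, h3] with ε h1 h2 h3 x₀ t ht htδ
  have hmeas : MeasurableSet (deform g ε '' S) :=
    (hS.isCompact.image (lipschitzWith_deform hg ε).continuous).measurableSet
  have hmass : μHE[n] (deform g ε '' S) ≤ 2 ^ n * μHE[n] S := by
    refine ((lipschitzWith_deform hg ε).lipschitzOnWith.euclideanHausdorffMeasure_image_le n).trans
      ?_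
    gcongr
    have : 1 + ‖ε‖₊ * L ≤ 2 := by
      rw [← NNReal.coe_le_coe]; push_cast; linarith
    exact_mod_cast this
  -- `A` is the nearly flat piece coming from the `r`-ball about a point of `S` within `r/4` of
  -- `x₀`, or empty if there is no such point. As points move by less than `r/8`, the rest stays at
  -- distance at least `r - r/4 - r/8`, respectively `r/4 - r/8`, from `x₀`.
  obtain ⟨A, hA, hfar⟩ : ∃ A : Set (AmbientSpace n),
      gaussianF n x₀ t (hypersurfaceMeasure n A) ≤ (K : ℝ≥0∞) ^ n ∧
      ∀ y ∈ deform g ε '' S, y ∉ A → r / 8 ≤ ‖y - x₀‖ := by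
    by_cases hx₀ : ∃ p ∈ S, ‖p - x₀‖ < r / 4
    · obtain ⟨p, hp, hpx⟩ := hx₀
      obtain ⟨π, hπ, hπc⟩ := hproj p hp
      refine ⟨deform g ε '' (S ∩ Metric.ball p r), ?_, ?_⟩
      · refine gaussianF_le_pow_of_projection π hπ ?_ x₀ ht
        rintro _ ⟨x, hx, rfl⟩ _ ⟨y, hy, rfl⟩
        exact norm_deform_le_of_projection hg π hπ (by linarith) K.coe_nonneg (by linarith)
          (hπc x hx y hy)
      · rintro _ ⟨x, hx, rfl⟩ hxA
        have hxr : r ≤ ‖x - p‖ := by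
          by_contra! h
          exact hxA ⟨x, ⟨hx, by rwa [mem_ball_iff_norm]⟩, rfl⟩
        have h4 := norm_deform_sub_le hM ε x hx
        have h5 : ‖x - p‖ ≤ ‖deform g ε x - x‖ + ‖deform g ε x - x₀‖ + ‖p - x₀‖ := by
          have h6 := norm_sub_le_norm_sub_add_norm_sub x (deform g ε x) p
          have h7 := norm_sub_le_norm_sub_add_norm_sub (deform g ε x) x₀ p
          rw [norm_sub_rev x (deform g ε x)] at h6
          rw [norm_sub_rev x₀ p] at h7
          linarith
        linarith
    · push Not at hx₀
      refine ⟨∅, by simp [gaussianF_hypersurfaceMeasure], ?_⟩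
      rintro _ ⟨x, hx, rfl⟩ -
      have h4 := norm_deform_sub_le hM ε x hx
      have h5 := hx₀ x hx
      have h6 := norm_sub_le_norm_sub_add_norm_sub x (deform g ε x) x₀
      rw [norm_sub_rev x (deform g ε x)] at h6
      linarith
  set B : Set (AmbientSpace n) := deform g ε '' S ∩ {y | r / 8 ≤ ‖y - x₀‖} with hB
  have hBm : MeasurableSet B :=
    hmeas.inter (isClosed_le (by fun_prop) (by fun_prop)).measurableSet
  have hsub : deform g ε '' S ⊆ A ∪ B := fun y hy => by
    by_cases hyA : y ∈ A
    · exact Or.inl hyA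
    · exact Or.inr ⟨hy, hfar y hy hyA⟩
  calc gaussianF n x₀ t (hypersurfaceMeasure n (deform g ε '' S))
      ≤ gaussianF n x₀ t (hypersurfaceMeasure n A) +
        gaussianF n x₀ t (hypersurfaceMeasure n B) :=
        (gaussianF_mono hsub x₀ t).trans (gaussianF_union_le x₀ t A B)
    _ ≤ (K : ℝ≥0∞) ^ n + gaussianConst n t *
        ENNReal.ofReal (Real.exp (-((r / 8) ^ 2 / 4) / t)) * (2 ^ n * μHE[n] S) := by
        gcongr
        refine (gaussianF_le_of_far hBm (by positivity) (fun y hy => hy.2) ht).trans ?_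
        gcongr
        exact (measure_mono Set.inter_subset_left).trans hmass
    _ ≤ c := (hδt ⟨ht, htδ⟩).le

theorem gaussianConst_eq_mul (n : ℕ) {a t : ℝ} (ha : 0 < a) (ht : 0 < t) :
    gaussianConst n t = ENNReal.ofReal (a ^ ((n : ℝ) / 2)) * gaussianConst n (a * t) := by
  unfold gaussianConst
  rw [← ENNReal.ofReal_mul (by positivity), mul_left_comm, Real.mul_rpow ha.le (by positivity)]
  congr 1
  have : 0 < a ^ ((n : ℝ) / 2) := by positivity
  field_simp

/-- Half of the exponent gives the decay outside the ball; the other half is a Gaussian at scale `2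
* s`, whose normalization costs `2 ^ (n/2)`. -/
theorem setLIntegral_compl_ball_gaussianWeight_le (z : EuclideanSpace ℝ (Fin n)) {ρ s : ℝ}
    (hρ : 0 ≤ ρ) (hs : 0 < s) :
    gaussianConst n s * ∫⁻ x in (Metric.ball z ρ)ᶜ, gaussianWeight z s x ∂μHE[n] ≤
      ENNReal.ofReal (2 ^ ((n : ℝ) / 2)) * ENNReal.ofReal (Real.exp (-(ρ ^ 2 / 8) / s)) := by
  have h1 : ∫⁻ x in (Metric.ball z ρ)ᶜ, gaussianWeight z s x ∂μHE[n] ≤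
      ∫⁻ x, ENNReal.ofReal (Real.exp (-(ρ ^ 2 / 8) / s)) * gaussianWeight z (2 * s) x ∂μHE[n] := by
    refine (setLIntegral_mono' measurableSet_ball.compl fun x hx => ?_).trans
      (setLIntegral_le_lintegral _ _)
    have hx' : ρ ≤ ‖x - z‖ := by simpa [dist_eq_norm] using hx
    unfold gaussianWeight
    rw [← ENNReal.ofReal_mul (Real.exp_pos _).le, ← Real.exp_add]
    refine ENNReal.ofReal_le_ofReal (Real.exp_le_exp.2 ?_)
    have h2 : ρ ^ 2 ≤ ‖x - z‖ ^ 2 := by gcongr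
    have h3 : -(ρ ^ 2 / 8) / s + -‖x - z‖ ^ 2 / (4 * (2 * s)) - -‖x - z‖ ^ 2 / (4 * s) =
        (‖x - z‖ ^ 2 - ρ ^ 2) / (8 * s) := by
      field_simp; ring
    have h4 : 0 ≤ (‖x - z‖ ^ 2 - ρ ^ 2) / (8 * s) := div_nonneg (by linarith) (by positivity)
    linarith
  rw [lintegral_const_mul _ (measurable_gaussianWeight _ _)] at h1
  calc _ ≤ gaussianConst n s * (ENNReal.ofReal (Real.exp (-(ρ ^ 2 / 8) / s)) *
        ∫⁻ x, gaussianWeight z (2 * s) x ∂μHE[n]) := by gcongr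
    _ = ENNReal.ofReal (2 ^ ((n : ℝ) / 2)) * ENNReal.ofReal (Real.exp (-(ρ ^ 2 / 8) / s)) *
        (gaussianConst n (2 * s) * ∫⁻ x, gaussianWeight z (2 * s) x ∂μHE[n]) := by
        rw [gaussianConst_eq_mul n two_pos hs]; ring
    _ = _ := by rw [gaussianConst_mul_lintegral_gaussianWeight n z (by positivity), mul_one]

theorem gaussianF_le_entropy (μ : Measure (AmbientSpace n)) (x₀ : AmbientSpace n) {t : ℝ}
    (ht : 0 < t) : gaussianF n x₀ t μ ≤ entropy n μ :=
  le_iSup_of_le x₀ (le_iSup_of_le t (le_iSup_of_le ht le_rfl))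

/-- A nonempty closed hypersurface has entropy at least `1`. -/
theorem IsClosedHypersurface.one_le_entropy (hS : IsClosedHypersurface n S) (hne : S.Nonempty) :
    1 ≤ entropy n (hypersurfaceMeasure n S) := by
  obtain ⟨p, hp⟩ := hne
  have key : ∀ q : ℝ, 1 < q → 1 ≤ ENNReal.ofReal ((q ^ 2) ^ ((n : ℝ) / 2)) *
      entropy n (hypersurfaceMeasure n S) := by
    intro q hq
    obtain ⟨π, hπ, ⟨r, hr, hπq⟩, hopen⟩ := hS.exists_local_projection hp hq
    obtain ⟨ρ, hρ, hball⟩ := Metric.mem_nhds_iff.1 (hopen r hr)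
    set A := S ∩ Metric.ball p r with hA
    have hAm : MeasurableSet A := hS.measurableSet.inter measurableSet_ball
    have hlip : LipschitzWith 1 π := fun x y =>
      edist_le_mul_edist_of_norm (by simpa [← map_sub] using hπ (x - y))
    -- Since `‖x - p‖ ≤ q ‖π x - π p‖`, the weight on `S` at scale `q² s` dominates the flat one at
    -- scale `s`; the normalizations differ by `(q²) ^ (n/2)`. Letting `s → 0` removes the tail, and
    -- then `q → 1`.
    have hbound : ∀ s : ℝ, 0 < s → 1 ≤ ENNReal.ofReal ((q ^ 2) ^ ((n : ℝ) / 2)) *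
        entropy n (hypersurfaceMeasure n S) +
        ENNReal.ofReal (2 ^ ((n : ℝ) / 2)) * ENNReal.ofReal (Real.exp (-(ρ ^ 2 / 8) / s)) := by
      intro s hs
      have hqs : 0 < q ^ 2 * s := by positivity
      have h1 : ∫⁻ z in Metric.ball (π p) ρ, gaussianWeight (π p) s z ∂μHE[n] ≤
          ∫⁻ x in A, gaussianWeight p (q ^ 2 * s) x ∂μHE[n] := by
        calc _ ≤ ∫⁻ z in π '' A, gaussianWeight (π p) s z ∂μHE[n] := lintegral_mono_set hball
          _ ≤ ∫⁻ x in A, gaussianWeight (π p) s (π x) ∂μHE[n] := by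
            simpa using hlip.setLIntegral_image_le n A (measurable_gaussianWeight (π p) s)
          _ ≤ _ := by
            refine setLIntegral_mono' hAm fun x hx => ?_
            have h2 := hπq x hx p ⟨hp, Metric.mem_ball_self hr⟩
            unfold gaussianWeight
            refine ENNReal.ofReal_le_ofReal (Real.exp_le_exp.2 ?_)
            rw [neg_div, neg_div, neg_le_neg_iff, div_le_div_iff₀ (by positivity) (by positivity)]
            have h3 : ‖x - p‖ ^ 2 ≤ q ^ 2 * ‖π x - π p‖ ^ 2 := by
              rw [← mul_pow]; gcongr
            nlinarith
      calc (1 : ℝ≥0∞) = gaussianConst n s * ∫⁻ z, gaussianWeight (π p) s z ∂μHE[n] :=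
            (gaussianConst_mul_lintegral_gaussianWeight n (π p) hs).symm
        _ = gaussianConst n s * ∫⁻ z in Metric.ball (π p) ρ, gaussianWeight (π p) s z ∂μHE[n] +
            gaussianConst n s * ∫⁻ z in (Metric.ball (π p) ρ)ᶜ,
              gaussianWeight (π p) s z ∂μHE[n] := by
            rw [← mul_add, lintegral_add_compl _ measurableSet_ball]
        _ ≤ _ := by
            refine add_le_add ?_ ?_
            · calc _ ≤ gaussianConst n s * ∫⁻ x in A, gaussianWeight p (q ^ 2 * s) x ∂μHE[n] := by
                    gcongr
                _ = ENNReal.ofReal ((q ^ 2) ^ ((n : ℝ) / 2)) *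
                    gaussianF n p (q ^ 2 * s) (hypersurfaceMeasure n A) := by
                    rw [gaussianF_hypersurfaceMeasure,
                      gaussianConst_eq_mul n (by positivity : 0 < q ^ 2) hs, mul_assoc]
                _ ≤ _ := by
                    gcongr
                    exact (gaussianF_mono Set.inter_subset_left p _).trans
                      (gaussianF_le_entropy _ p hqs)
            · exact setLIntegral_compl_ball_gaussianWeight_le (π p) hρ.le hs
    have hlim : Tendsto (fun s : ℝ => ENNReal.ofReal (Real.exp (-(ρ ^ 2 / 8) / s)))
        (𝓝[>] 0) (𝓝 0) := by
      -- In dimension 0 the normalizing constant is 1.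
      simpa [gaussianConst] using
        tendsto_gaussianConst_mul_exp 0 (a := ρ ^ 2 / 8) (by positivity)
    have hlim' := (ENNReal.Tendsto.const_mul (a := ENNReal.ofReal (2 ^ ((n : ℝ) / 2))) hlim
      (Or.inr ENNReal.ofReal_ne_top)).const_add (ENNReal.ofReal ((q ^ 2) ^ ((n : ℝ) / 2)) *
        entropy n (hypersurfaceMeasure n S))
    rw [mul_zero, add_zero] at hlim'
    exact ge_of_tendsto hlim' (by
      filter_upwards [self_mem_nhdsWithin] with s hs using hbound s hs)
  have hq : Tendsto (fun q : ℝ => ENNReal.ofReal ((q ^ 2) ^ ((n : ℝ) / 2))) (𝓝[>] 1) (𝓝 1) := by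
    have hcont : Continuous fun q : ℝ => (q ^ 2) ^ ((n : ℝ) / 2) :=
      (continuous_pow 2).rpow_const fun _ => Or.inr (by positivity)
    have h := ENNReal.tendsto_ofReal (hcont.tendsto' 1 1 (by simp))
    rw [ENNReal.ofReal_one] at h
    exact h.mono_left nhdsWithin_le_nhds
  have hlim := ENNReal.Tendsto.mul_const (b := entropy n (hypersurfaceMeasure n S)) hq
    (Or.inl one_ne_zero)
  rw [one_mul] at hlim
  exact ge_of_tendsto hlim (by filter_upwards [self_mem_nhdsWithin] with q hq using key q hq)

end SmallScales

/-! ### Continuity of the entropy -/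

section Entropy

variable {n : ℕ}

theorem gaussianF_add (x₀ : AmbientSpace n) (t : ℝ) (μ μ' : Measure (AmbientSpace n)) :
    gaussianF n x₀ t (μ + μ') = gaussianF n x₀ t μ + gaussianF n x₀ t μ' := by
  simp [gaussianF, lintegral_add_measure, mul_add]

theorem gaussianF_nsmul (x₀ : AmbientSpace n) (t : ℝ) (k : ℕ) (μ : Measure (AmbientSpace n)) :
    gaussianF n x₀ t (k • μ) = k * gaussianF n x₀ t μ := by
  rw [gaussianF, lintegral_smul_measure, nsmul_eq_mul, mul_left_comm, gaussianF]

theorem entropy_nsmul (k : ℕ) (μ : Measure (AmbientSpace n)) :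
    entropy n (k • μ) = k * entropy n μ := by
  simp only [entropy, gaussianF_nsmul, ENNReal.mul_iSup]

theorem entropy_add_le (μ μ' : Measure (AmbientSpace n)) :
    entropy n (μ + μ') ≤ entropy n μ + entropy n μ' := by
  refine iSup_le fun x₀ => iSup_le fun t => iSup_le fun ht => ?_
  rw [gaussianF_add]
  exact add_le_add (gaussianF_le_entropy μ x₀ ht) (gaussianF_le_entropy μ' x₀ ht)

variable {S : Set (AmbientSpace n)} {g : AmbientSpace n → AmbientSpace n} {L : ℝ≥0}

theorem tendsto_deform_upper_bound (L : ℝ≥0) (M s : ℝ) (x : ℝ≥0∞) {C H : ℝ≥0∞}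
    (hC : C ≠ ⊤) (hH : H ≠ ⊤) :
    Tendsto (fun ε : ℝ => ((1 + ‖ε‖₊ * L : ℝ≥0) : ℝ≥0∞) ^ n *
      (x + C * (ENNReal.ofReal (‖ε‖ * M / s) * H))) (𝓝 0) (𝓝 x) := by
  have h1 : Tendsto (fun ε : ℝ => ((1 + ‖ε‖₊ * L : ℝ≥0) : ℝ≥0∞) ^ n) (𝓝 0) (𝓝 1) :=
    Continuous.tendsto' (by fun_prop) 0 1 (by simp)
  have h2 : Tendsto (fun ε : ℝ => ENNReal.ofReal (‖ε‖ * M / s)) (𝓝 0) (𝓝 0) :=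
    Continuous.tendsto' (ENNReal.continuous_ofReal.comp (by fun_prop)) 0 0 (by simp)
  have h3 := (ENNReal.Tendsto.const_mul (a := C)
    (ENNReal.Tendsto.mul_const (b := H) h2 (Or.inr hH)) (Or.inr hC)).const_add x
  rw [zero_mul, mul_zero, add_zero] at h3
  simpa using ENNReal.Tendsto.mul h1 (Or.inl one_ne_zero) h3 (Or.inr ENNReal.one_ne_top)

theorem tendsto_deform_lower_bound (L : ℝ≥0) (M s : ℝ) (x : ℝ≥0∞) {C H : ℝ≥0∞}
    (hC : C ≠ ⊤) (hH : H ≠ ⊤) :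
    Tendsto (fun ε : ℝ => (((1 - ‖ε‖₊ * L)⁻¹ : ℝ≥0) : ℝ≥0∞) ^ n * x +
      C * (ENNReal.ofReal (‖ε‖ * M / s) * H)) (𝓝 0) (𝓝 x) := by
  have h1 : Tendsto (fun ε : ℝ => (((1 - ‖ε‖₊ * L)⁻¹ : ℝ≥0) : ℝ≥0∞) ^ n) (𝓝 0) (𝓝 1) := by
    have h0 : Tendsto (fun ε : ℝ => 1 - ‖ε‖₊ * L) (𝓝 0) (𝓝 1) :=
      Continuous.tendsto' (by fun_prop) 0 1 (by simp)
    have h := ((ENNReal.continuous_pow n).tendsto _).comp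
      (ENNReal.tendsto_coe.2 (h0.inv₀ one_ne_zero))
    simpa [Function.comp_def] using h
  have h2 : Tendsto (fun ε : ℝ => ENNReal.ofReal (‖ε‖ * M / s)) (𝓝 0) (𝓝 0) :=
    Continuous.tendsto' (ENNReal.continuous_ofReal.comp (by fun_prop)) 0 0 (by simp)
  have h3 := (ENNReal.Tendsto.mul_const (b := x) h1 (Or.inl one_ne_zero)).add
    (ENNReal.Tendsto.const_mul (a := C)
      (ENNReal.Tendsto.mul_const (b := H) h2 (Or.inr hH)) (Or.inr hC))
  simpa using h3

/-- At a fixed centre and scale the Gaussian functional is continuous under deformation. -/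
theorem IsClosedHypersurface.tendsto_gaussianF_deform (hS : IsClosedHypersurface n S)
    (hg : LipschitzWith L g) (x₀ : AmbientSpace n) {t : ℝ} (ht : 0 < t) :
    Tendsto (fun ε => gaussianF n x₀ t (hypersurfaceMeasure n (deform g ε '' S))) (𝓝 0)
      (𝓝 (gaussianF n x₀ t (hypersurfaceMeasure n S))) := by
  obtain ⟨M, hM⟩ := hS.isCompact.exists_bound_of_continuousOn hg.continuous.continuousOn
  have hC := gaussianConst_ne_top n t
  have hH := hS.measure_lt_top.ne
  refine tendsto_order.2 ⟨fun a ha => ?_, fun b hb => ?_⟩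
  · have h1 : ∀ᶠ ε in 𝓝 (0 : ℝ), ‖ε‖₊ * L < 1 :=
      (Continuous.tendsto' (by fun_prop) 0 0 (by simp)).eventually_lt_const one_pos
    filter_upwards [h1,
      (tendsto_deform_lower_bound (n := n) L M (2 * √t) a hC hH).eventually_lt_const ha]
      with ε hε hlt
    -- A deformed value at most `a` would, by `gaussianF_le_deform`, bound the undeformed value by
    -- the quantity in `hlt`, which is smaller.
    by_contra! hle
    refine hlt.not_ge ((gaussianF_le_deform hS.measurableSet hg hM hε x₀ ht).trans ?_)
    gcongr
  · filter_upwards [(tendsto_deform_upper_bound (n := n) L M (2 * √t) _ hC hH).eventually_lt_const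
      hb] with ε hlt
    exact (gaussianF_deform_le hS.measurableSet hg hM ε x₀ ht le_rfl).trans_lt hlt

theorem IsClosedHypersurface.entropy_lt_top (hS : IsClosedHypersurface n S) :
    entropy n (hypersurfaceMeasure n S) < ⊤ := by
  -- The zero field turns the statement about deformations into one about `S` itself.
  obtain ⟨δ, hδ, h⟩ := hS.exists_small_scale_bound (g := fun _ => 0) (L := 0)
    (LipschitzWith.const 0) ENNReal.one_lt_two
  have h0 := h.self_of_nhds
  have hid : deform (fun _ : AmbientSpace n => (0 : AmbientSpace n)) 0 '' S = S :=
    (Set.image_congr fun x _ => by simp [deform]).trans (Set.image_id S)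
  rw [hid] at h0
  refine lt_of_le_of_lt (b := max 2 (gaussianConst n δ * μHE[n] S)) ?_ (max_lt (by simp)
    (ENNReal.mul_lt_top (gaussianConst_ne_top n δ).lt_top hS.measure_lt_top))
  refine iSup_le fun x₀ => iSup_le fun t => iSup_le fun ht => ?_
  rcases lt_or_ge t δ with htδ | htδ
  · exact le_max_of_le_left (h0 x₀ t ht htδ)
  · refine le_max_of_le_right ?_
    rw [gaussianF_hypersurfaceMeasure]
    refine mul_le_mul' (gaussianConst_anti n hδ htδ) ?_
    calc _ ≤ ∫⁻ _ in S, 1 ∂μHE[n] := lintegral_mono fun x => gaussianWeight_le_one x₀ ht x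
      _ = _ := by simp

/-- The entropy of a closed hypersurface is continuous under Lipschitz deformations. -/
theorem IsClosedHypersurface.tendsto_entropy_deform (hS : IsClosedHypersurface n S)
    (hg : LipschitzWith L g) :
    Tendsto (fun ε => entropy n (hypersurfaceMeasure n (deform g ε '' S))) (𝓝 0)
      (𝓝 (entropy n (hypersurfaceMeasure n S))) := by
  -- The empty hypersurface has entropy 0, so the lower bound 1 used below needs `hne`.
  rcases S.eq_empty_or_nonempty with rfl | hne
  · simp
  obtain ⟨M, hM⟩ := hS.isCompact.exists_bound_of_continuousOn hg.continuous.continuousOn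
  refine tendsto_order.2 ⟨fun a ha => ?_, fun b hb => ?_⟩
  · simp only [entropy, lt_iSup_iff] at ha
    obtain ⟨x₀, t, ht, ha⟩ := ha
    filter_upwards [(hS.tendsto_gaussianF_deform hg x₀ ht).eventually_const_lt ha] with ε hε
    exact hε.trans_le (gaussianF_le_entropy _ x₀ ht)
  · obtain ⟨c, hc, hcb⟩ := exists_between hb
    -- Here `c` exceeds the entropy, hence exceeds 1, and is admissible at small scales.
    obtain ⟨δ, hδ, hsmall⟩ := hS.exists_small_scale_bound hg ((hS.one_le_entropy hne).trans_lt hc)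
    filter_upwards [hsmall, (tendsto_deform_upper_bound (n := n) L M (2 * √δ) _
      (gaussianConst_ne_top n δ) hS.measure_lt_top.ne).eventually_lt_const hc] with ε h1 h2
    refine lt_of_le_of_lt ?_ hcb
    refine iSup_le fun x₀ => iSup_le fun t => iSup_le fun ht => ?_
    rcases lt_or_ge t δ with htδ | htδ
    · exact h1 x₀ t ht htδ
    · refine (gaussianF_deform_le hS.measurableSet hg hM ε x₀ hδ htδ).trans (le_trans ?_ h2.le)
      gcongr
      exact gaussianF_le_entropy _ x₀ ht

/-- Smoothness gives local Lipschitz bounds for `f • ν`, compactness a global one on `S`, and finite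
dimension of the target a Lipschitz extension to the whole space. -/
theorem IsClosedHypersurface.exists_normalGraph_eq_deform (hS : IsClosedHypersurface n S)
    {ν : AmbientSpace n → AmbientSpace n} (hν : IsSmoothOnHypersurface S ν)
    {f : AmbientSpace n → ℝ} (hf : IsSmoothOnHypersurface S f) :
    ∃ (g : AmbientSpace n → AmbientSpace n) (L : ℝ≥0), LipschitzWith L g ∧
      ∀ ε : ℝ, normalGraph S ν (fun x => ε * f x) = deform g ε '' S := by
  obtain ⟨K, hK⟩ :=
    (hf.smul hν).locallyLipschitzOn.exists_lipschitzOnWith_of_compact hS.isCompact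
  obtain ⟨g, hg, hgS⟩ := hK.extend_finite_dimension
  refine ⟨g, _, hg, fun ε => Set.image_congr fun x hx => ?_⟩
  rw [deform, ← hgS hx, smul_smul]

end Entropy

theorem mainTheorem6 (n : ℕ) (S : Set (AmbientSpace n)) (hS : IsClosedHypersurface n S)
    (ν : AmbientSpace n → AmbientSpace n) (hν : IsUnitNormalField S ν)
    (f : AmbientSpace n → ℝ) (hf : IsSmoothOnHypersurface S f) (m : ℕ) (hm : 1 ≤ m) :
    entropy n (m • hypersurfaceMeasure n S) < ⊤ ∧
      Tendsto
        (fun ε : ℝ => entropy n ((m - 1) • hypersurfaceMeasure n S +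
          hypersurfaceMeasure n (normalGraph S ν (fun x => ε * f x))))
        (𝓝 0) (𝓝 (entropy n (m • hypersurfaceMeasure n S))) := by
  obtain ⟨g, L, hg, hgraph⟩ := hS.exists_normalGraph_eq_deform hν.smooth hf
  -- With `m = k + 1` the truncated subtraction `m - 1` becomes `k`.
  obtain ⟨k, rfl⟩ := Nat.exists_eq_add_of_le' hm
  have htop := hS.entropy_lt_top
  simp only [hgraph, Nat.add_sub_cancel]
  refine ⟨?_, tendsto_order.2 ⟨fun a ha => ?_, fun b hb => ?_⟩⟩
  · rw [entropy_nsmul]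
    exact ENNReal.mul_lt_top (ENNReal.natCast_lt_top _) htop
  -- For the lower bound a single centre and scale must serve both summands, so the functional of
  -- the sum is used rather than the separate entropies.
  · simp only [entropy, lt_iSup_iff] at ha
    obtain ⟨x₀, t, ht, ha⟩ := ha
    have hlim := (hS.tendsto_gaussianF_deform hg x₀ ht).const_add
      (gaussianF n x₀ t (k • hypersurfaceMeasure n S))
    rw [← gaussianF_add, ← succ_nsmul] at hlim
    filter_upwards [hlim.eventually_const_lt ha] with ε hε
    rw [← gaussianF_add] at hε
    exact hε.trans_le (gaussianF_le_entropy _ x₀ ht)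
  · have hlim := (hS.tendsto_entropy_deform hg).const_add
      (entropy n (k • hypersurfaceMeasure n S))
    have hsum : entropy n (k • hypersurfaceMeasure n S) + entropy n (hypersurfaceMeasure n S) =
        entropy n ((k + 1) • hypersurfaceMeasure n S) := by
      rw [entropy_nsmul, entropy_nsmul, Nat.cast_succ, add_one_mul]
    rw [hsum] at hlim
    filter_upwards [hlim.eventually_lt_const hb] with ε hε
    exact (entropy_add_le _ _).trans_lt hε
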